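/- Let $K$ be a field of characteristic zero. For an abelian group $G$ (written additively), a *colour map* is a map $\theta:G\times G\to K^{\times}$ with $\theta(a,b)\theta(b,a)=1$, $\theta(a,b+c)=\theta(a,b)\theta(a,c)$ and $\theta(a+b,c)=\theta(a,c)\theta(b,c)$ for all $a,b,c\in G$. A *$(G,\theta)$-graded Lie algebra* is a $K$-vector space $L=\bigoplus_{a\in G}L_a$ with a bilinear bracket $[\cdot,\cdot]:L\times L\to L$ such that, for all $a,b,c\in G$ and $X\in L_a$, $Y\in L_b$, $Z\in L_c$: $$[X,Y]\in L_{a+b},\qquad [X,Y]=-\theta(a,b)[Y,X],$$ $$\theta(c,a)[X,[Y,Z]]+\theta(b,c)[Z,[X,Y]]+\theta(a,b)[Y,[Z,X]]=0.$$ A *Lie superalgebra* is such an algebra for $G=\mathbb Z/2\mathbb Z$ and $\theta(a,b)=(-1)^{ab}$; a *Klein graded Lie algebra* is such an algebra for $G=\mathbb Z/2\mathbb Z\times\mathbb Z/2\mathbb Z$ and an arbitrary colour map $\theta$. A homogeneous element of degree $g$ is called *odd* if $\theta(g,g)=-1$ (for a Lie superalgebra: if $g=1$). The *universal enveloping algebra*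 $U(L)$ is the quotient of the tensor algebra $T(L)$ by the two-sided ideal generated by all elements $X\otimes Y-\theta(a,b)\,Y\otimes X-[X,Y]$ with $X\in L_a$, $Y\in L_b$, $a,b\in G$, and $\sigma:L\to U(L)$ is the canonical linear map. **Theorem (Poincaré–Birkhoff–Witt).** Let $L$ be a Lie superalgebra or a Klein graded Lie algebra over $K$ (possibly infinite-dimensional), and let $(E_i)_{i\in I}$ be a basis of $L$ consisting of homogeneous elements and indexed by a totally ordered set $I$. Let $H$ be the set of all finite sequences $(i_1,\dots,i_r)$ in $I$, $r\ge 0$, such that $i_1\le i_2\le\dots\le i_r$ and $i_p<i_{p+1}$ whenever $E_{i_p}$ and $E_{i_{p+1}}$ are both odd. Then the family of monomials $$\sigma(E_{i_1})\sigma(E_{i_2})\cdots\sigma(E_{i_r}),\qquad (i_1,\dots,i_r)\in H$$ (the empty sequence giving $1$), is a basis of the vector space $U(L)$. -/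

import Mathlib

/-- A colour map on the (additively written) abelian group `G`, with values in `Kˣ`. -/
structure ColorMap (K G : Type*) [Field K] [AddCommGroup G] where
  toFun : G → G → Kˣ
  mul_swap : ∀ a b, toFun a b * toFun b a = 1
  map_add_right : ∀ a b c, toFun a (b + c) = toFun a b * toFun a c
  map_add_left : ∀ a b c, toFun (a + b) c = toFun a c * toFun b c

instance (K G : Type*) [Field K] [AddCommGroup G] :
    CoeFun (ColorMap K G) (fun _ => G → G → Kˣ) := ⟨ColorMap.toFun⟩

/-- The colour map `(a, b) ↦ (-1)^(ab)` on `ℤ/2ℤ`. -/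
def superColor (K : Type*) [Field K] : ColorMap K (ZMod 2) where
  toFun a b := (-1) ^ (a.val * b.val)
  mul_swap a b := by
    rw [mul_comm b.val a.val, ← mul_pow]; simp
  map_add_right a b c := by
    have h : ∀ a b c : ZMod 2,
        (a.val * (b + c).val) % 2 = (a.val * b.val + a.val * c.val) % 2 := by decide
    have h2 : (-1 : Kˣ) ^ 2 = 1 := by simp
    rw [← pow_add, pow_eq_pow_mod _ h2, h a b c, ← pow_eq_pow_mod _ h2]
  map_add_left a b c := by
    have h : ∀ a b c : ZMod 2,
        ((a + b).val * c.val) % 2 = (a.val * c.val + b.val * c.val) % 2 := by decide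
    have h2 : (-1 : Kˣ) ^ 2 = 1 := by simp
    rw [← pow_add, pow_eq_pow_mod _ h2, h a b c, ← pow_eq_pow_mod _ h2]

/-- A `(G, θ)`-graded Lie algebra structure on the `K`-vector space `L`. -/
structure ColorLieAlgebra {K G : Type*} [Field K] [AddCommGroup G] [DecidableEq G]
    (θ : ColorMap K G) (L : Type*) [AddCommGroup L] [Module K L] where
  /-- The homogeneous components `L_a`. -/
  grading : G → Submodule K L
  isInternal : DirectSum.IsInternal grading
  /-- The bilinear bracket. -/
  bracket : L →ₗ[K] L →ₗ[K] L
  bracket_mem : ∀ {a b : G} {x y : L}, x ∈ grading a → y ∈ grading b →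
    bracket x y ∈ grading (a + b)
  skew : ∀ {a b : G} {x y : L}, x ∈ grading a → y ∈ grading b →
    bracket x y = -((θ a b : K) • bracket y x)
  jacobi : ∀ {a b c : G} {x y z : L}, x ∈ grading a → y ∈ grading b → z ∈ grading c →
    (θ c a : K) • bracket x (bracket y z) + (θ b c : K) • bracket z (bracket x y)
      + (θ a b : K) • bracket y (bracket z x) = 0

/-- A Lie superalgebra is a `ℤ/2ℤ`-graded Lie algebra for the colour `(-1)^(ab)`. -/
abbrev LieSuperalgebra (K L : Type*) [Field K] [AddCommGroup L] [Module K L] :=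
  ColorLieAlgebra (superColor K) L

/-- The Klein four-group, written additively. -/
abbrev KleinGroup := ZMod 2 × ZMod 2

/-- A Klein graded Lie algebra, for an arbitrary colour map on the Klein four-group. -/
abbrev KleinGradedLieAlgebra {K : Type*} [Field K] (θ : ColorMap K KleinGroup)
    (L : Type*) [AddCommGroup L] [Module K L] :=
  ColorLieAlgebra θ L

namespace ColorLieAlgebra

variable {K G : Type*} [Field K] [AddCommGroup G] [DecidableEq G] {θ : ColorMap K G}
  {L : Type*} [AddCommGroup L] [Module K L]

/-- The generators of the two-sided ideal of the tensor algebra that is divided out: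
`Rel A t 0` holds exactly for `t = x ⊗ y - θ(a,b) y ⊗ x - [x,y]`
with `x` and `y` homogeneous of degrees `a` and `b`. -/
inductive Rel (A : ColorLieAlgebra θ L) : TensorAlgebra K L → TensorAlgebra K L → Prop
  | of {a b : G} {x y : L} (hx : x ∈ A.grading a) (hy : y ∈ A.grading b) :
      Rel A (TensorAlgebra.ι K x * TensorAlgebra.ι K y
          - (θ a b : K) • (TensorAlgebra.ι K y * TensorAlgebra.ι K x)
          - TensorAlgebra.ι K (A.bracket x y)) 0

/-- The enveloping algebra: the quotient of the tensor algebra by the two-sided ideal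
generated by the elements in `Rel`. -/
abbrev EnvelopingAlgebra (A : ColorLieAlgebra θ L) := RingQuot A.Rel

/-- The canonical map from `L` to its enveloping algebra. -/
noncomputable def σ (A : ColorLieAlgebra θ L) : L →ₗ[K] A.EnvelopingAlgebra :=
  (RingQuot.mkAlgHom K A.Rel).toLinearMap ∘ₗ TensorAlgebra.ι K

/-- `x` is homogeneous of some degree. -/
def IsHomogeneous (A : ColorLieAlgebra θ L) (x : L) : Prop := ∃ g, x ∈ A.grading g

/-- `x` is homogeneous of a degree `g` with `θ(g,g) = -1`. -/
def IsOdd (A : ColorLieAlgebra θ L) (x : L) : Prop := ∃ g, θ g g = -1 ∧ x ∈ A.grading g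

/-- The product `σ(b i₁) ⋯ σ(b iᵣ)` (equal to `1` for the empty sequence). -/
noncomputable def monomial (A : ColorLieAlgebra θ L) {I : Type*} (b : I → L) (N : List I) :
    A.EnvelopingAlgebra :=
  (N.map fun i => A.σ (b i)).prod

end ColorLieAlgebra

/-- The finite sequences `i₁ ≤ i₂ ≤ ⋯ ≤ iᵣ` (`r ≥ 0`) such that `iₚ < iₚ₊₁` whenever
`iₚ` and `iₚ₊₁` are both odd. -/
def orderedSeqs {I : Type*} [LinearOrder I] (odd : I → Prop) : Set (List I) :=
  {N | N.IsChain fun i j => i ≤ j ∧ (odd i → odd j → i < j)}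

/-!
The Poincaré–Birkhoff–Witt theorem holds for every grading group `G` and every colour map `θ`; this
is `ColorLieAlgebra.pbw`, and Lie superalgebras and Klein graded Lie algebras are special cases.

The idea is to let the enveloping algebra `U(L)` act on the vector space `V` with basis the symbols
`z_N` of the ordered sequences `N` in such a way that the monomial of `N` sends the symbol of the
empty sequence to `z_N`. Then the map `U(L) → V`, `u ↦ u z_∅`, shows that the monomials are linearly
independent. Conversely, the linear map `φ : V → U(L)` sending `z_N` to the monomial of `N` is
`U(L)`-linear (`linearCombination_rep`), so that `u = u φ(z_∅) = φ(u z_∅)` for every `u`, and the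
monomials span.

The action of a basis vector `i` on `z_N` is forced, and is defined by recursion on the length of
`N` (`straighten`): it is `z_{iN}` if `iN` is ordered; otherwise `N = jM`, and it is
`θ(i,j) j (i z_M) + [i,j] z_M` if `j < i`, and `½ [i,i] z_M` if `i = j` is odd. Here `j` is applied to
terms as long as `N`, but those are of the form `z_P` with `jP` ordered, where `j` acts by
`z_P ↦ z_{jP}` (`straighten_mem_supported`).

That the relation `i j = θ(i,j) j i + [i,j]` holds on `z_N` is proved by induction on the length of
`N` (`comm_single`). It holds by definition if `jN` is ordered and `i j` is not. If `N = kM` with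
`k < j ≤ i`, then `z_N = k z_M`, and the relation for `i`, `j` on `k z_M` follows from known instances
and the Jacobi identity (`Comm.act_of_act`). The remaining case is `N = jM` with `j` odd, where
`j j = ½ [j,j]` and `[j,[j,j]] = 0` are used (`Comm.act_self`).
-/

/-! ### Straightening of sequences -/

open Finsupp in
/-- The action of the `i`-th basis vector on the symbol of the sequence `N`, expanded in symbols of
sequences, for commutation factors `t i j` and structure constants `c i j`. It is determined by
requiring that an ordered `i :: N` be the result of the action, and that the commutation relations
`i j = t i j • j i + c i j` and `2 • i i = c i i` (for `i` odd) hold; it is meaningful for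
`N ∈ orderedSeqs odd` only.

In the case `j < i`, the sequences `P` longer than `M` that occur in the action of `i` on `M` are
leading terms, and acting on them with `j` merely puts `j` in front (`straighten_of_lt`). Writing
`j :: P` there makes the recursion decrease the length. -/
noncomputable def straighten {K I : Type*} [Field K] [LinearOrder I] (odd : I → Prop)
    (t : I → I → K) (c : I → I → I →₀ K) (i : I) (N : List I) : List I →₀ K :=
  open Classical in
  if i :: N ∈ orderedSeqs odd then single (i :: N) 1 else
  match N with
  | [] => 0
  | j :: M =>
    if i = j then (2⁻¹ : K) • (c i i).sum fun k r => r • straighten odd t c k M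
    else t i j • ((straighten odd t c i M).sum fun P r =>
        r • if _h : P.length ≤ M.length then straighten odd t c j P else single (j :: P) 1)
      + (c i j).sum fun k r => r • straighten odd t c k M
termination_by N.length

section OrderedSeqs

variable {I : Type*} [LinearOrder I] {odd : I → Prop}

theorem nil_mem_orderedSeqs : [] ∈ orderedSeqs odd := List.isChain_nil

theorem singleton_mem_orderedSeqs (i : I) : [i] ∈ orderedSeqs odd := List.isChain_singleton i

theorem cons_cons_mem_orderedSeqs {i j : I} {M : List I} :
    i :: j :: M ∈ orderedSeqs odd ↔
      (i ≤ j ∧ (odd i → odd j → i < j)) ∧ j :: M ∈ orderedSeqs odd :=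
  List.isChain_cons_cons

theorem of_cons_mem_orderedSeqs {i : I} {M : List I} (h : i :: M ∈ orderedSeqs odd) :
    M ∈ orderedSeqs odd :=
  List.IsChain.of_cons h

/-- The sequences that may occur in the action of `i` on `N`: ordered, at most one longer than `N`,
and, if of this maximal length, such that every `j < i` that can be put in front of `N` can be put
in front of them. -/
def leadingSeqs (odd : I → Prop) (i : I) (N : List I) : Set (List I) :=
  {P | P ∈ orderedSeqs odd ∧ P.length ≤ N.length + 1 ∧
    (P.length = N.length + 1 → ∀ j < i, j :: N ∈ orderedSeqs odd → j :: P ∈ orderedSeqs odd)}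

end OrderedSeqs

section Straighten

open Finsupp

variable {K I : Type*} [Field K] [LinearOrder I] {odd : I → Prop}
  {t : I → I → K} {c : I → I → I →₀ K}

theorem straighten_of_mem {i : I} {N : List I} (h : i :: N ∈ orderedSeqs odd) :
    straighten odd t c i N = single (i :: N) 1 := by
  rw [straighten.eq_def, if_pos h]

theorem straighten_self {i : I} {M : List I} (hi : odd i) :
    straighten odd t c i (i :: M)
      = (2⁻¹ : K) • (c i i).sum fun k r => r • straighten odd t c k M := by
  rw [straighten, if_neg, if_pos rfl]
  rw [cons_cons_mem_orderedSeqs]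
  exact fun h => lt_irrefl _ (h.1.2 hi hi)

/-- The recursive equation for `j < i`, before the case distinction in it is removed. -/
theorem straighten_of_lt_aux {i j : I} {M : List I} (hij : j < i) :
    straighten odd t c i (j :: M)
      = t i j • ((straighten odd t c i M).sum fun P r =>
        r • if P.length ≤ M.length then straighten odd t c j P else single (j :: P) 1)
      + (c i j).sum fun k r => r • straighten odd t c k M := by
  rw [straighten, if_neg, if_neg hij.ne']
  · rfl
  rw [cons_cons_mem_orderedSeqs]
  exact fun h => hij.not_ge h.1.1

theorem straighten_mem_supported (N : List I) : ∀ (i : I), N ∈ orderedSeqs odd →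
    straighten odd t c i N ∈ supported K K (leadingSeqs odd i N) := by
  induction hn : N.length using Nat.strong_induction_on generalizing N with
  | _ n ih =>
  subst hn
  intro i hN
  by_cases hi : i :: N ∈ orderedSeqs odd
  · rw [straighten_of_mem hi]
    refine single_mem_supported K _ ⟨hi, le_rfl, fun _ j hj _ => ?_⟩
    exact cons_cons_mem_orderedSeqs.2 ⟨⟨hj.le, fun _ _ => hj⟩, hi⟩
  cases N with
  | nil => exact absurd (singleton_mem_orderedSeqs i) hi
  | cons j M =>
  have hM := of_cons_mem_orderedSeqs hN
  -- Acting on sequences of length at most `M.length` produces no leading terms.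
  have low : ∀ k P, P ∈ orderedSeqs odd → P.length ≤ M.length →
      straighten odd t c k P ∈ supported K K (leadingSeqs odd i (j :: M)) := by
    intro k P hP hPM
    refine supported_mono ?_ (ih P.length (by simpa using hPM) P rfl k hP)
    rintro Q ⟨hQ, hle, -⟩
    refine ⟨hQ, by simp; omega, fun h => ?_⟩
    simp at h; omega
  have br : ∀ f : I →₀ K, (f.sum fun k r => r • straighten odd t c k M) ∈
      supported K K (leadingSeqs odd i (j :: M)) := fun f =>
    Submodule.sum_mem _ fun k _ => Submodule.smul_mem _ _ (low k M hM le_rfl)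
  rw [cons_cons_mem_orderedSeqs, and_iff_left hN] at hi
  rcases lt_trichotomy i j with h | h | h
  · exact absurd ⟨h.le, fun _ _ => h⟩ hi
  · subst h
    have hodd : odd i := by
      by_contra ho
      exact hi ⟨le_rfl, fun h => absurd h ho⟩
    rw [straighten_self hodd]
    exact Submodule.smul_mem _ _ (br _)
  · rw [straighten_of_lt_aux h]
    refine Submodule.add_mem _ (Submodule.smul_mem _ _ (Submodule.sum_mem _ fun P hP =>
      Submodule.smul_mem _ _ ?_)) (br _)
    obtain ⟨hP1, hP2, hP3⟩ :=
      (mem_supported K _).1 (ih M.length (by simp) M rfl i hM) hP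
    split_ifs with hle
    · exact low j P hP1 hle
    · have hjP := hP3 (by omega) j h hN
      refine single_mem_supported K _ ⟨hjP, by simpa using hP2, fun _ k _ hk' => ?_⟩
      exact cons_cons_mem_orderedSeqs.2 ⟨(cons_cons_mem_orderedSeqs.1 hk').1, hjP⟩

theorem straighten_of_lt {i j : I} {M : List I} (hij : j < i) (hM : j :: M ∈ orderedSeqs odd) :
    straighten odd t c i (j :: M)
      = t i j • ((straighten odd t c i M).sum fun P r => r • straighten odd t c j P)
      + (c i j).sum fun k r => r • straighten odd t c k M := by
  -- The two sides differ only on the leading terms of `straighten odd t c i M`.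
  rw [straighten_of_lt_aux hij]
  congr 2
  refine Finsupp.sum_congr fun P hP => ?_
  obtain ⟨-, hP2, hP3⟩ := (mem_supported K _).1
    (straighten_mem_supported (t := t) (c := c) M i (of_cons_mem_orderedSeqs hM)) hP
  split_ifs with hle
  · rfl
  · rw [straighten_of_mem (hP3 (by omega) j hij hM)]

end Straighten

/-! ### Colour maps and colour Lie algebras -/

section ColorMap

variable {K G : Type*} [Field K] [AddCommGroup G] (θ : ColorMap K G)

theorem ColorMap.coe_mul_swap (a b : G) : (θ a b : K) * θ b a = 1 := by
  rw [← Units.val_mul, θ.mul_swap, Units.val_one]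

theorem ColorMap.self_eq_one_or (a : G) : θ a a = 1 ∨ θ a a = -1 := by
  have h := θ.coe_mul_swap a a
  rcases mul_self_eq_one_iff.1 h with h | h
  · exact Or.inl (Units.ext h)
  · exact Or.inr (Units.ext (by simpa using h))

end ColorMap

namespace ColorLieAlgebra

section General

variable {K G : Type*} [Field K] [AddCommGroup G] [DecidableEq G] {θ : ColorMap K G}
  {L : Type*} [AddCommGroup L] [Module K L]

/-- The Jacobi identity, in the form that bracketing with `x` is a colour derivation. -/
theorem jacobi_leibniz (A : ColorLieAlgebra θ L) {a b c : G} {x y z : L}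
    (hx : x ∈ A.grading a) (hy : y ∈ A.grading b) (hz : z ∈ A.grading c) :
    A.bracket x (A.bracket y z) =
      A.bracket (A.bracket x y) z + (θ a b : K) • A.bracket y (A.bracket x z) := by
  have h := congrArg ((θ a c : K) • ·) (A.jacobi hx hy hz)
  have h1 := θ.coe_mul_swap a c
  rw [A.skew (A.bracket_mem hx hy) hz, A.skew hx hz, θ.map_add_left]
  simp only [smul_add, smul_smul, smul_zero, h1, one_smul] at h
  simp only [map_neg, map_smul, smul_neg, smul_smul, Units.val_mul]
  linear_combination (norm := module) h

/-- A homogeneous basis contains a basis of each homogeneous component. -/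
theorem mem_span_of_mem_grading (A : ColorLieAlgebra θ L) {I : Type*} (b : Module.Basis I K L)
    (d : I → G) (hd : ∀ i, b i ∈ A.grading (d i)) {a : G} {x : L} (hx : x ∈ A.grading a) :
    x ∈ Submodule.span K (b '' {i | d i = a}) := by
  set S := Submodule.span K (b '' {i | d i = a})
  have hS : S ≤ A.grading a := by
    refine Submodule.span_le.2 ?_
    rintro _ ⟨i, rfl, rfl⟩
    exact hd i
  have hx' : x ∈ S ⊔ ⨆ g ≠ a, A.grading g := by
    have : (⊤ : Submodule K L) ≤ S ⊔ ⨆ g ≠ a, A.grading g := by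
      rw [← b.span_eq, Submodule.span_le]
      rintro _ ⟨i, rfl⟩
      by_cases h : d i = a
      · exact Submodule.mem_sup_left (Submodule.subset_span ⟨i, h, rfl⟩)
      · exact Submodule.mem_sup_right
          (Submodule.mem_iSup_of_mem (d i) (Submodule.mem_iSup_of_mem h (hd i)))
    exact this trivial
  obtain ⟨y, hy, z, hz, rfl⟩ := Submodule.mem_sup.1 hx'
  have hz' : z ∈ A.grading a := by simpa using Submodule.sub_mem _ hx (hS hy)
  have := Submodule.disjoint_def.1 (A.isInternal.submodule_iSupIndep a) z hz' hz
  simpa [this] using hy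

theorem grading_unique (A : ColorLieAlgebra θ L) {a a' : G} {x : L} (hx : x ∈ A.grading a)
    (hx' : x ∈ A.grading a') (h0 : x ≠ 0) : a = a' := by
  by_contra h
  exact h0 (Submodule.disjoint_def.1
    (A.isInternal.submodule_iSupIndep.pairwiseDisjoint h) x hx hx')

theorem bracket_self_eq_zero [CharZero K] (A : ColorLieAlgebra θ L) {a : G} {x : L}
    (hx : x ∈ A.grading a) (ha : θ a a = 1) : A.bracket x x = 0 := by
  have h := A.skew hx hx
  rw [ha, Units.val_one, one_smul] at h
  have h2 : (2 : K) • A.bracket x x = 0 := by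
    rw [two_smul]
    nth_rw 1 [h]
    exact neg_add_cancel _
  exact (smul_eq_zero.1 h2).resolve_left two_ne_zero

/-- The defining relation of the enveloping algebra. -/
theorem σ_mul_σ (A : ColorLieAlgebra θ L) {a a' : G} {x y : L} (hx : x ∈ A.grading a)
    (hy : y ∈ A.grading a') :
    A.σ x * A.σ y = (θ a a' : K) • (A.σ y * A.σ x) + A.σ (A.bracket x y) := by
  have h := RingQuot.mkAlgHom_rel K (Rel.of hx hy)
  simp only [map_sub, map_mul, map_smul, map_zero] at h
  simp only [σ, LinearMap.comp_apply, AlgHom.toLinearMap_apply]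
  rw [sub_sub, sub_eq_zero] at h
  exact h

theorem monomial_cons (A : ColorLieAlgebra θ L) {I : Type*} (b : I → L) (i : I) (N : List I) :
    A.monomial b (i :: N) = A.σ (b i) * A.monomial b N := by
  simp [monomial]

end General

/-! ### The action on ordered sequences -/

section Action

variable {K G : Type*} [Field K] [AddCommGroup G] [DecidableEq G] {θ : ColorMap K G}
  {L : Type*} [AddCommGroup L] [Module K L] {I : Type*} [LinearOrder I]

/-- The linear extension of `straighten` to the action of `L` on the space spanned by symbols of
sequences in `I`. It respects the bracket on the span of the ordered sequences only. -/
noncomputable def act (A : ColorLieAlgebra θ L) (b : Module.Basis I K L) (d : I → G)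
    (odd : I → Prop) : L →ₗ[K] (List I →₀ K) →ₗ[K] (List I →₀ K) :=
  b.constr K fun i => Finsupp.linearCombination K
    (straighten odd (fun i j => (θ (d i) (d j) : K)) (fun i j => b.repr (A.bracket (b i) (b j))) i)

variable (A : ColorLieAlgebra θ L) (b : Module.Basis I K L) (d : I → G) {odd : I → Prop}

theorem act_basis_single (i : I) (N : List I) :
    A.act b d odd (b i) (.single N 1) = straighten odd (fun i j => (θ (d i) (d j) : K))
      (fun i j => b.repr (A.bracket (b i) (b j))) i N := by
  simp [act]

theorem act_basis_apply (i : I) (v : List I →₀ K) :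
    A.act b d odd (b i) v = v.sum fun P r => r • straighten odd (fun i j => (θ (d i) (d j) : K))
      (fun i j => b.repr (A.bracket (b i) (b j))) i P := by
  simp [act, Finsupp.linearCombination_apply]

theorem act_single (x : L) (N : List I) :
    A.act b d odd x (.single N 1) = (b.repr x).sum fun k r =>
      r • straighten odd (fun i j => (θ (d i) (d j) : K))
      (fun i j => b.repr (A.bracket (b i) (b j))) k N := by
  rw [act, Module.Basis.constr_apply, Finsupp.sum, LinearMap.sum_apply]
  simp [Finsupp.sum]

theorem act_single_of_mem {i : I} {N : List I} (h : i :: N ∈ orderedSeqs odd) :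
    A.act b d odd (b i) (.single N 1) = .single (i :: N) 1 := by
  rw [act_basis_single, straighten_of_mem h]

theorem act_single_self {i : I} {M : List I} (hi : odd i) :
    A.act b d odd (b i) (.single (i :: M) 1)
      = (2⁻¹ : K) • A.act b d odd (A.bracket (b i) (b i)) (.single M 1) := by
  rw [act_basis_single, straighten_self hi, act_single]

theorem act_single_of_lt {i j : I} {M : List I} (hij : j < i) (hM : j :: M ∈ orderedSeqs odd) :
    A.act b d odd (b i) (.single (j :: M) 1)
      = (θ (d i) (d j) : K) • A.act b d odd (b j) (A.act b d odd (b i) (.single M 1))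
        + A.act b d odd (A.bracket (b i) (b j)) (.single M 1) := by
  rw [act_basis_single, straighten_of_lt hij hM, A.act_basis_single b d i M,
    act_basis_apply, act_single]

theorem act_basis_single_mem {N : List I} (i : I) (hN : N ∈ orderedSeqs odd) :
    A.act b d odd (b i) (.single N 1) ∈ Finsupp.supported K K (leadingSeqs odd i N) := by
  rw [act_basis_single]
  exact straighten_mem_supported N i hN

theorem act_mem_supported (x : L) {v : List I →₀ K}
    (hv : v ∈ Finsupp.supported K K (orderedSeqs odd)) :
    A.act b d odd x v ∈ Finsupp.supported K K (orderedSeqs odd) := by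
  rw [← b.linearCombination_repr x, Finsupp.linearCombination_apply, Finsupp.sum, map_sum,
    LinearMap.sum_apply]
  refine Submodule.sum_mem _ fun i _ => ?_
  rw [map_smul, LinearMap.smul_apply]
  refine Submodule.smul_mem _ _ ?_
  rw [act_basis_apply]
  refine Submodule.sum_mem _ fun P hP => Submodule.smul_mem _ _ ?_
  exact Finsupp.supported_mono (fun Q hQ => hQ.1)
    (straighten_mem_supported P i ((Finsupp.mem_supported K _).1 hv hP))

/-- The actions of `x` and `y`, taken to be of degrees `a` and `a'`, satisfy on the vector `v` the
commutation relation `x y = θ(a,a') y x + [x,y]`. -/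
def Comm (odd : I → Prop) (a a' : G) (x y : L) (v : List I →₀ K) : Prop :=
  A.act b d odd x (A.act b d odd y v)
    = (θ a a' : K) • A.act b d odd y (A.act b d odd x v) + A.act b d odd (A.bracket x y) v

variable {A b d}

theorem Comm.symm {a a' : G} {x y : L} {v : List I →₀ K} (hx : x ∈ A.grading a)
    (hy : y ∈ A.grading a') (h : A.Comm b d odd a a' x y v) : A.Comm b d odd a' a y x v := by
  unfold Comm at *
  rw [h, A.skew hy hx, smul_add, smul_smul, θ.coe_mul_swap, one_smul, map_neg, map_smul,
    LinearMap.neg_apply, LinearMap.smul_apply, add_neg_cancel_right]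

theorem Comm.of_basis (hd : ∀ i, b i ∈ A.grading (d i)) {v : List I →₀ K}
    (h : ∀ i j, A.Comm b d odd (d i) (d j) (b i) (b j) v) {a a' : G} {x y : L}
    (hx : x ∈ A.grading a) (hy : y ∈ A.grading a') : A.Comm b d odd a a' x y v := by
  unfold Comm at *
  replace hx := A.mem_span_of_mem_grading b d hd hx
  replace hy := A.mem_span_of_mem_grading b d hd hy
  induction hx using Submodule.span_induction with
  | zero => simp
  | add x x' _ _ h1 h2 =>
    simp only [map_add, LinearMap.add_apply, h1, h2]; module
  | smul r x _ h1 =>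
    simp only [map_smul, LinearMap.smul_apply, h1]; module
  | mem x hx =>
    obtain ⟨i, rfl, rfl⟩ := hx
    induction hy using Submodule.span_induction with
    | zero => simp
    | add x x' _ _ h1 h2 =>
      simp only [map_add, LinearMap.add_apply, h1, h2]; module
    | smul r x _ h1 =>
      simp only [map_smul, LinearMap.smul_apply, h1]; module
    | mem x hx =>
      obtain ⟨j, rfl, rfl⟩ := hx
      exact h i j

theorem Comm.of_support {a a' : G} {x y : L} {v : List I →₀ K}
    (h : ∀ P ∈ v.support, A.Comm b d odd a a' x y (.single P 1)) :
    A.Comm b d odd a a' x y v := by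
  unfold Comm at *
  rw [← Finsupp.sum_single v, Finsupp.sum]
  simp only [map_sum, Finset.smul_sum, ← Finset.sum_add_distrib]
  refine Finset.sum_congr rfl fun P hP => ?_
  rw [← mul_one (v P), ← smul_eq_mul, ← Finsupp.smul_single]
  simp only [map_smul, h P hP, smul_add, smul_comm (v P)]

/-- The overlap of `i j` and `j k`: both ways of straightening `i j k` give the same result, by the
Jacobi identity. -/
theorem Comm.act_of_act (hd : ∀ i, b i ∈ A.grading (d i))
    {i j k : I} {v : List I →₀ K}
    (ih : ∀ i j, A.Comm b d odd (d i) (d j) (b i) (b j) v)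
    (hi : A.Comm b d odd (d i) (d k) (b i) (b k) (A.act b d odd (b j) v))
    (hj : A.Comm b d odd (d j) (d k) (b j) (b k) (A.act b d odd (b i) v)) :
    A.Comm b d odd (d i) (d j) (b i) (b j) (A.act b d odd (b k) v) := by
  have e1 := ih j k
  have e2 := ih i k
  have e0 := ih i j
  have e3 := Comm.of_basis hd ih (hd i) (A.bracket_mem (hd j) (hd k))
  have e4 := Comm.of_basis hd ih (hd j) (A.bracket_mem (hd i) (hd k))
  have e5 := Comm.of_basis hd ih (A.bracket_mem (hd i) (hd j)) (hd k)
  unfold Comm at *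
  rw [e1, e2, e5]
  simp only [map_add, map_smul, hi, hj, e3, e4, e0, A.jacobi_leibniz (hd i) (hd j) (hd k),
    θ.map_add_left, θ.map_add_right, Units.val_mul, LinearMap.add_apply, LinearMap.smul_apply]
  have h1 := θ.coe_mul_swap (d i) (d j)
  have h2 : (θ (d i) (d j) : K) * ((θ (d j) (d i) : K) * θ (d j) (d k)) = θ (d j) (d k) := by
    rw [← mul_assoc, h1, one_mul]
  simp only [smul_add, smul_smul, h2]
  module

variable [CharZero K]

/-- If `j` can be put in front of `N`, the relation for `i ≥ j` on `N` is built into the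
definition of the action. -/
theorem Comm.of_cons_mem (hodd : ∀ i, odd i ↔ θ (d i) (d i) = -1) {i j : I} {N : List I}
    (hij : j < i ∨ (i = j ∧ odd i)) (hN : j :: N ∈ orderedSeqs odd) :
    A.Comm b d odd (d i) (d j) (b i) (b j) (.single N 1) := by
  unfold Comm
  rw [act_single_of_mem A b d hN]
  rcases hij with h | ⟨rfl, h⟩
  · exact act_single_of_lt A b d h hN
  · rw [act_single_of_mem A b d hN, act_single_self A b d h, (hodd i).1 h]
    simp only [Units.val_neg, Units.val_one, neg_smul, one_smul]
    module

/-- The relation between `i` and `k` holds on the action of `j` on `M`: it is known on the lower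
terms, and `k` can be put in front of the leading terms. -/
theorem Comm.act_single (hodd : ∀ i, odd i ↔ θ (d i) (d i) = -1) {i j k : I} {M : List I}
    (ih : ∀ P ∈ orderedSeqs odd, P.length ≤ M.length → ∀ i j,
      A.Comm b d odd (d i) (d j) (b i) (b j) (.single P 1))
    (hM : k :: M ∈ orderedSeqs odd) (hik : k < i ∨ (i = k ∧ odd i)) (hjk : k < j) :
    A.Comm b d odd (d i) (d k) (b i) (b k) (A.act b d odd (b j) (.single M 1)) := by
  refine Comm.of_support fun P hP => ?_
  obtain ⟨hP1, hP2, hP3⟩ := (Finsupp.mem_supported K _).1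
    (act_basis_single_mem A b d j (of_cons_mem_orderedSeqs hM)) hP
  rcases Nat.lt_or_ge M.length P.length with h | h
  · exact Comm.of_cons_mem hodd hik (hP3 (by omega) k hjk hM)
  · exact ih P hP1 h i k

/-- The overlap of `i j` and `j j` for odd `j`. When `i = j` it amounts to `[j, [j, j]] = 0`, which
is where `3 ≠ 0` is needed. -/
theorem Comm.act_self (hd : ∀ i, b i ∈ A.grading (d i))
    {i j : I} {v : List I →₀ K} (hj : θ (d j) (d j) = -1)
    (ih : ∀ i j, A.Comm b d odd (d i) (d j) (b i) (b j) v)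
    (hi : i ≠ j → A.Comm b d odd (d j) (d j) (b j) (b j) (A.act b d odd (b i) v)) :
    A.Comm b d odd (d i) (d j) (b i) (b j) (A.act b d odd (b j) v) := by
  have sq_of : ∀ {w : List I →₀ K}, A.Comm b d odd (d j) (d j) (b j) (b j) w →
      A.act b d odd (b j) (A.act b d odd (b j) w)
        = (2⁻¹ : K) • A.act b d odd (A.bracket (b j) (b j)) w := by
    intro w hw
    unfold Comm at hw
    rw [hj] at hw
    simp only [Units.val_neg, Units.val_one] at hw
    linear_combination (norm := module) (2⁻¹ : K) • hw
  have e1 := sq_of (ih j j)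
  have e2 := ih i j
  have e3 := Comm.of_basis hd ih (hd i) (A.bracket_mem (hd j) (hd j))
  have e4 := Comm.of_basis hd ih (hd j) (A.bracket_mem (hd i) (hd j))
  have hjac : ∀ k, A.bracket (b k) (A.bracket (b j) (b j))
      = (2 * θ (d k) (d j) : K) • A.bracket (b j) (A.bracket (b k) (b j)) := by
    intro k
    have h := A.jacobi_leibniz (hd k) (hd j) (hd j)
    rw [A.skew (A.bracket_mem (hd k) (hd j)) (hd j), θ.map_add_left, hj] at h
    simp only [Units.val_mul, Units.val_neg, Units.val_one] at h
    linear_combination (norm := module) h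
  have hcube : A.bracket (b j) (A.bracket (b j) (b j)) = 0 := by
    have h := hjac j
    rw [hj] at h
    have h3 : (3 : K) • A.bracket (b j) (A.bracket (b j) (b j)) = 0 := by
      simp only [Units.val_neg, Units.val_one] at h
      linear_combination (norm := module) h
    exact (smul_eq_zero.1 h3).resolve_left three_ne_zero
  have e5 : A.act b d odd (b j) (A.act b d odd (b j) (A.act b d odd (b i) v))
      = (2⁻¹ : K) • A.act b d odd (A.bracket (b j) (b j)) (A.act b d odd (b i) v) := by
    by_cases hij : i = j
    · subst hij
      unfold Comm at e3
      rw [e1, map_smul, e3, hcube, θ.map_add_right, hj]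
      simp
    · exact sq_of (hi hij)
  unfold Comm at *
  rw [e1, map_smul, e3, e2]
  simp only [map_add, map_smul, e4, e5, hjac i, θ.map_add_right, hj, Units.val_mul,
    Units.val_neg, Units.val_one, LinearMap.smul_apply]
  have h1 := θ.coe_mul_swap (d i) (d j)
  have h2 : (θ (d i) (d j) : K) * ((θ (d j) (d i) : K) * -1) = -1 := by
    rw [← mul_assoc, h1, one_mul]
  simp only [smul_add, smul_smul, h2]
  module

/-- The action satisfies the commutation relations on every ordered sequence. -/
theorem comm_single (hd : ∀ i, b i ∈ A.grading (d i)) (hodd : ∀ i, odd i ↔ θ (d i) (d i) = -1)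
    (N : List I) (hN : N ∈ orderedSeqs odd) (i j : I) :
    A.Comm b d odd (d i) (d j) (b i) (b j) (.single N 1) := by
  induction hn : N.length using Nat.strong_induction_on generalizing N i j with
  | _ n ih =>
  subst hn
  -- By skew symmetry, and since even `i` commute with themselves, it suffices to treat the pairs
  -- `i`, `j` that are out of order.
  have key : ∀ i j, (j < i ∨ (i = j ∧ odd i)) →
      A.Comm b d odd (d i) (d j) (b i) (b j) (.single N 1) := by
    intro i j hij
    by_cases hjN : j :: N ∈ orderedSeqs odd
    · exact Comm.of_cons_mem hodd hij hjN
    cases N with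
    | nil => exact absurd (singleton_mem_orderedSeqs j) hjN
    | cons k M =>
    have ih' : ∀ P ∈ orderedSeqs odd, P.length ≤ M.length → ∀ i j,
        A.Comm b d odd (d i) (d j) (b i) (b j) (.single P 1) := fun P hP hl i j =>
      ih P.length (by simpa using hl) P hP i j rfl
    have ihM := ih' M (of_cons_mem_orderedSeqs hN) le_rfl
    rw [← act_single_of_mem A b d hN]
    rw [cons_cons_mem_orderedSeqs, and_iff_left hN] at hjN
    rcases lt_trichotomy k j with hkj | rfl | hkj
    · have hki : k < i := by
        rcases hij with h | ⟨rfl, -⟩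
        exacts [hkj.trans h, hkj]
      exact Comm.act_of_act hd ihM (Comm.act_single hodd ih' hN (.inl hki) hkj)
        (Comm.act_single hodd ih' hN (.inl hkj) hki)
    · have hk : odd k := by
        by_contra ho
        exact hjN ⟨le_rfl, fun h => absurd h ho⟩
      refine Comm.act_self hd ((hodd k).1 hk) ihM fun hne => ?_
      rcases hij with h | ⟨h, -⟩
      · exact Comm.act_single hodd ih' hN (.inr ⟨rfl, hk⟩) h
      · exact absurd h hne
    · exact absurd ⟨hkj.le, fun _ _ => hkj⟩ hjN
  rcases lt_trichotomy i j with h | rfl | h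
  · exact (key j i (.inl h)).symm (hd j) (hd i)
  · by_cases hi : odd i
    · exact key i i (.inr ⟨rfl, hi⟩)
    · have h1 := (θ.self_eq_one_or (d i)).resolve_right (fun h => hi ((hodd i).2 h))
      unfold Comm
      rw [h1, A.bracket_self_eq_zero (hd i) h1]
      simp
  · exact key i j (.inl h)

theorem comm_of_mem (hd : ∀ i, b i ∈ A.grading (d i)) (hodd : ∀ i, odd i ↔ θ (d i) (d i) = -1)
    {v : List I →₀ K} (hv : v ∈ Finsupp.supported K K (orderedSeqs odd)) {a a' : G} {x y : L}
    (hx : x ∈ A.grading a) (hy : y ∈ A.grading a') : A.Comm b d odd a a' x y v :=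
  Comm.of_basis hd (fun i j => Comm.of_support fun P hP =>
    comm_single hd hodd P ((Finsupp.mem_supported K _).1 hv hP) i j) hx hy

/-! ### The representation of the enveloping algebra -/

/-- The codomain is only assumed to be a semiring: instance search finds no ring structure on the
endomorphisms of `Finsupp.supported K K s`. -/
theorem map_sub_eq_map_zero_of_eq {K R S : Type*} [CommRing K] [Ring R] [Algebra K R]
    [Semiring S] [Algebra K S] {f : R →ₐ[K] S} {x y : R} (h : f x = f y) : f (x - y) = f 0 := by
  rw [sub_eq_add_neg, map_add, h, ← map_add, add_neg_cancel]

variable (A b d odd) in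
/-- The action of `L` on the space spanned by the ordered sequences. -/
noncomputable def actOrdered :
    L →ₗ[K] Module.End K (Finsupp.supported K K (orderedSeqs odd)) where
  toFun x := (A.act b d odd x).restrict fun _ hv => A.act_mem_supported b d x hv
  map_add' x y := by ext1 v; simp [LinearMap.restrict_apply]
  map_smul' r x := by ext1 v; simp [LinearMap.restrict_apply]

/-- The representation of the enveloping algebra on the space spanned by the ordered sequences. -/
noncomputable def rep (hd : ∀ i, b i ∈ A.grading (d i))
    (hodd : ∀ i, odd i ↔ θ (d i) (d i) = -1) :
    A.EnvelopingAlgebra →ₐ[K] Module.End K (Finsupp.supported K K (orderedSeqs odd)) :=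
  RingQuot.liftAlgHom K ⟨TensorAlgebra.lift K (A.actOrdered b d odd), by
    rintro _ _ ⟨hx, hy⟩
    rw [sub_sub]
    refine map_sub_eq_map_zero_of_eq ?_
    ext1 v
    have h := comm_of_mem hd hodd v.2 hx hy
    unfold Comm at h
    rw [map_mul, map_add, map_smul, map_mul]
    simp only [TensorAlgebra.lift_ι_apply]
    refine Subtype.ext ?_
    simpa [actOrdered, LinearMap.restrict_apply] using h⟩

theorem coe_rep_σ (hd : ∀ i, b i ∈ A.grading (d i)) (hodd : ∀ i, odd i ↔ θ (d i) (d i) = -1)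
    (x : L) (v : Finsupp.supported K K (orderedSeqs odd)) :
    (rep hd hodd (A.σ x) v : List I →₀ K) = A.act b d odd x v := by
  simp [rep, σ, actOrdered, LinearMap.restrict_apply]

/-- Monomials applied to the empty sequence give back their sequence of indices. -/
theorem coe_rep_monomial (hd : ∀ i, b i ∈ A.grading (d i))
    (hodd : ∀ i, odd i ↔ θ (d i) (d i) = -1) (N : List I) (hN : N ∈ orderedSeqs odd) :
    (rep hd hodd (A.monomial b N)
      ⟨.single [] 1, Finsupp.single_mem_supported K _ nil_mem_orderedSeqs⟩ : List I →₀ K)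
      = .single N 1 := by
  induction N with
  | nil => simp [monomial]
  | cons i N ih =>
    rw [monomial, List.map_cons, List.prod_cons, map_mul, Module.End.mul_apply, coe_rep_σ]
    erw [ih (of_cons_mem_orderedSeqs hN)]
    exact act_single_of_mem A b d hN

/-- The map sending an ordered sequence to its monomial turns the action of `x` into left
multiplication by `σ x`. -/
theorem linearCombination_act_single (hd : ∀ i, b i ∈ A.grading (d i))
    (hodd : ∀ i, odd i ↔ θ (d i) (d i) = -1) (N : List I) (hN : N ∈ orderedSeqs odd) (x : L) :
    Finsupp.linearCombination K (A.monomial b) (A.act b d odd x (.single N 1))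
      = A.σ x * A.monomial b N := by
  induction hn : N.length using Nat.strong_induction_on generalizing N x with
  | _ n ih =>
  subst hn
  suffices H : ∀ i, Finsupp.linearCombination K (A.monomial b)
      (A.act b d odd (b i) (.single N 1)) = A.σ (b i) * A.monomial b N by
    have : Finsupp.linearCombination K (A.monomial b) ∘ₗ (A.act b d odd).flip (.single N 1)
        = LinearMap.mulRight K (A.monomial b N) ∘ₗ A.σ := b.ext fun i => by simpa using H i
    simpa using LinearMap.congr_fun this x
  intro i
  have base : ∀ {i N}, i :: N ∈ orderedSeqs odd → Finsupp.linearCombination K (A.monomial b)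
      (A.act b d odd (b i) (.single N 1)) = A.σ (b i) * A.monomial b N := by
    intro i N h
    rw [act_single_of_mem A b d h, Finsupp.linearCombination_single, one_smul, monomial_cons]
  by_cases hi : i :: N ∈ orderedSeqs odd
  · exact base hi
  cases N with
  | nil => exact absurd (singleton_mem_orderedSeqs i) hi
  | cons j M =>
  have hM := of_cons_mem_orderedSeqs hN
  have low := fun P hP (hl : P.length ≤ M.length) x => ih P.length (by simpa using hl) P hP x rfl
  rw [cons_cons_mem_orderedSeqs, and_iff_left hN] at hi
  rcases lt_trichotomy i j with h | rfl | h
  · exact absurd ⟨h.le, fun _ _ => h⟩ hi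
  · have ho : odd i := by
      by_contra ho
      exact hi ⟨le_rfl, fun h => absurd h ho⟩
    have h2 := A.σ_mul_σ (hd i) (hd i)
    rw [(hodd i).1 ho, Units.val_neg, Units.val_one] at h2
    have h3 : A.σ (b i) * A.σ (b i) = (2⁻¹ : K) • A.σ (A.bracket (b i) (b i)) := by
      linear_combination (norm := module) (2⁻¹ : K) • h2
    rw [act_single_self A b d ho, map_smul, low M hM le_rfl, monomial_cons, ← mul_assoc, h3,
      smul_mul_assoc]
  -- `j` acts on the lower terms by induction, and on the leading ones by putting `j` in front.
  · have hmul : ∀ v ∈ Finsupp.supported K K (leadingSeqs odd i M),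
        Finsupp.linearCombination K (A.monomial b) (A.act b d odd (b j) v)
          = A.σ (b j) * Finsupp.linearCombination K (A.monomial b) v := by
      intro v hv
      rw [← Finsupp.sum_single v, Finsupp.sum]
      simp only [map_sum, Finset.mul_sum]
      refine Finset.sum_congr rfl fun P hP => ?_
      rw [← mul_one (v P), ← smul_eq_mul, ← Finsupp.smul_single]
      simp only [map_smul, Finsupp.linearCombination_single, one_smul, mul_smul_comm]
      congr 1
      obtain ⟨hP1, hP2, hP3⟩ := (Finsupp.mem_supported K _).1 hv hP
      rcases Nat.lt_or_ge M.length P.length with hl | hl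
      · exact base (hP3 (by omega) j h hN)
      · exact low P hP1 hl (b j)
    rw [act_single_of_lt A b d h hN, map_add, map_smul, hmul _ (act_basis_single_mem A b d i hM),
      low M hM le_rfl, low M hM le_rfl, monomial_cons, ← mul_assoc, ← mul_assoc,
      A.σ_mul_σ (hd i) (hd j), add_mul, smul_mul_assoc]

theorem linearCombination_rep (hd : ∀ i, b i ∈ A.grading (d i))
    (hodd : ∀ i, odd i ↔ θ (d i) (d i) = -1) (u : A.EnvelopingAlgebra)
    (v : Finsupp.supported K K (orderedSeqs odd)) :
    Finsupp.linearCombination K (A.monomial b) (rep hd hodd u v : List I →₀ K)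
      = u * Finsupp.linearCombination K (A.monomial b) (v : List I →₀ K) := by
  obtain ⟨w, rfl⟩ := RingQuot.mkAlgHom_surjective K A.Rel u
  induction w using TensorAlgebra.induction generalizing v with
  | algebraMap r => simp [Algebra.smul_def]
  | add w w' h h' => simp only [map_add, LinearMap.add_apply, Submodule.coe_add, h, h', add_mul]
  | mul w w' h h' => rw [map_mul, map_mul, Module.End.mul_apply, h, h', mul_assoc]
  | ι x =>
    change Finsupp.linearCombination K (A.monomial b) (rep hd hodd (A.σ x) v : List I →₀ K)
      = A.σ x * _
    rw [coe_rep_σ]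
    obtain ⟨v, hv⟩ := v
    dsimp only
    rw [← Finsupp.sum_single v, Finsupp.sum]
    simp only [map_sum, Finset.mul_sum]
    refine Finset.sum_congr rfl fun P hP => ?_
    rw [← mul_one (v P), ← smul_eq_mul, ← Finsupp.smul_single]
    simp only [map_smul, Finsupp.linearCombination_single, one_smul, mul_smul_comm]
    rw [linearCombination_act_single hd hodd P ((Finsupp.mem_supported K _).1 hv hP)]

/-- The Poincaré–Birkhoff–Witt theorem for a Lie algebra graded by an arbitrary abelian group with
an arbitrary colour map. -/
theorem pbw (hd : ∀ i, b i ∈ A.grading (d i)) (hodd : ∀ i, odd i ↔ θ (d i) (d i) = -1) :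
    LinearIndependent K (fun N : orderedSeqs odd => A.monomial b N.1) ∧
      Submodule.span K (Set.range (fun N : orderedSeqs odd => A.monomial b N.1)) = ⊤ := by
  let e : Finsupp.supported K K (orderedSeqs odd) :=
    ⟨.single [] 1, Finsupp.single_mem_supported K _ nil_mem_orderedSeqs⟩
  constructor
  · refine LinearIndependent.of_comp ((Finsupp.supported K K (orderedSeqs odd)).subtype ∘ₗ
      (rep hd hodd).toLinearMap.flip e) ?_
    convert (Finsupp.linearIndependent_single_one K (List I)).comp _ Subtype.val_injective
      using 1
    ext1 N
    exact coe_rep_monomial hd hodd N.1 N.2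
  · refine Submodule.eq_top_iff'.2 fun u => ?_
    have h := linearCombination_rep hd hodd u e
    rw [Finsupp.linearCombination_single, one_smul, monomial, List.map_nil, List.prod_nil,
      mul_one] at h
    have h' := (Finsupp.mem_span_image_iff_linearCombination K).2 ⟨_, (rep hd hodd u e).2, h⟩
    rwa [Set.image_eq_range] at h'

end Action

end ColorLieAlgebra

theorem mainTheorem1 {K : Type*} [Field K] [CharZero K]
    {L : Type*} [AddCommGroup L] [Module K L]
    {I : Type*} [LinearOrder I] (b : Module.Basis I K L) :
    (∀ A : LieSuperalgebra K L, (∀ i, b i ∈ A.grading 0 ∨ b i ∈ A.grading 1) →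
      LinearIndependent K
        (fun N : orderedSeqs (fun i => b i ∈ A.grading 1) => A.monomial b N.1) ∧
      Submodule.span K (Set.range
        (fun N : orderedSeqs (fun i => b i ∈ A.grading 1) => A.monomial b N.1)) = ⊤) ∧
    (∀ (θ : ColorMap K KleinGroup) (A : KleinGradedLieAlgebra θ L),
      (∀ i, A.IsHomogeneous (b i)) →
      LinearIndependent K
        (fun N : orderedSeqs (fun i => A.IsOdd (b i)) => A.monomial b N.1) ∧
      Submodule.span K (Set.range
        (fun N : orderedSeqs (fun i => A.IsOdd (b i)) => A.monomial b N.1)) = ⊤) := by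
  refine ⟨fun A hb => ?_, fun θ A hb => ?_⟩
  · classical
    refine ColorLieAlgebra.pbw (d := fun i => if b i ∈ A.grading 1 then 1 else 0)
      (fun i => ?_) (fun i => ?_)
    · split_ifs with h
      exacts [h, (hb i).resolve_right h]
    · have hne : (1 : Kˣ) ≠ -1 := fun h => by
        have := congrArg Units.val h
        rw [Units.val_neg, Units.val_one] at this
        exact (neg_ne_self.2 one_ne_zero) this.symm
      split_ifs with h
      · simp [h, superColor, ZMod.val_one]
      · simp [h, superColor, hne]
  · choose d hd using hb
    refine ColorLieAlgebra.pbw hd fun i => ⟨?_, fun h => ⟨d i, h, hd i⟩⟩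
    rintro ⟨g, hg, hi⟩
    rwa [← A.grading_unique hi (hd i) (b.ne_zero i)]
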